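/- Conventions. For a set $S$ of morphisms of a category $\mathcal M$, let $\mathrm{inj}(S)$ be the class of morphisms with the right lifting property with respect to $S$, let $\mathrm{cof}(S)$ be the class of morphisms with the left lifting property with respect to $\mathrm{inj}(S)$, and let $\mathrm{cell}(S)$ be the class of transfinite compositions of pushouts of morphisms in $S$. Given a class of cofibrations, an object $X$ is cofibrant if the morphism from the initial object to $X$ is a cofibration. A class $\mathscr W$ of morphisms is $\kappa$-accessible ($\kappa$ a regular cardinal) if the full subcategory of the arrow category of $\mathcal M$ spanned by $\mathscr W$ is closed under $\kappa$-filtered colimits and is a $\kappa$-accessible category. A semi-model structure on $\mathcal M$ consists of classes $\mathscr W$ (weak equivalences), $\mathscr F$ (fibrations) and $\mathscr Q$ (cofibrations) such that, calling the elements of $\mathscr F\cap\mathscr W$ trivial fibrations and those of $\mathscr Q\cap\mathscr W$ trivial cofibrations: the initial object is cofibrant; $\mathscr W$ has the two out of three property; $\mathscr W,\mathscr F,\mathscr Q$ are closed under retracts; cofibrations have the left lifting property with respect to trivial fibrations, and trivial cofibrations with cofibrant domain have it with respect to fibrations; every morphism factors functorially as a cofibration followed by a trivial fibration, and every morphism with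 cofibrant domain factors functorially (on the full subcategory of arrows with cofibrant domain) as a trivial cofibration followed by a fibration; fibrations are closed under pullback. It is combinatorial, with generating cofibrations $I$ and generating trivial cofibrations $J$, if $\mathcal M$ is bicomplete and locally presentable and $I$, $J$ are sets of morphisms such that $\mathrm{inj}(I)=\mathscr F\cap\mathscr W$, $\mathrm{inj}(J)=\mathscr F$, the domains of $I$ are small relative to $\mathrm{cell}(I)$, and the domains of $J$ are small relative to the morphisms in $\mathrm{cell}(J)$ with cofibrant domain. Theorem. Let $\mathcal M$ be a locally presentable category with a class $\mathscr W$ of morphisms and a set $I$ of morphisms. Call the elements of $\mathrm{cof}(I)$ cofibrations and those of $\mathrm{cof}(I)\cap\mathscr W$ trivial cofibrations. Suppose that: (1) the class $\mathscr W$ is $\kappa$-accessible for some regular cardinal $\kappa$; (2) $\mathscr W$ is closed under retracts and has the two out of three property; (3) $\mathrm{inj}(I)\subseteq\mathscr W$; (4) any pushout of a trivial cofibration with cofibrant domain along a morphism to a cofibrant object is a trivial cofibration, and any transfinite composition, starting at a cofibrant object, of trivial cofibrations with cofibrant domain is a trivial cofibration; (5) the morphisms of $I$ have cofibrant domain and the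 initial object of $\mathcal M$ is cofibrant. Then there is a set $J$ of trivial cofibrations with cofibrant domain such that $\mathscr W$ (weak equivalences), $\mathrm{cof}(I)$ (cofibrations) and $\mathrm{inj}(J)$ (fibrations) form a combinatorial semi-model structure on $\mathcal M$ with generating cofibrations $I$ and generating trivial cofibrations $J$. -/

import Mathlib

universe w v u

open CategoryTheory Limits

namespace SemiModel

section Classes

variable {C : Type u} [Category.{v} C]

/-- `cof S`: the morphisms with the left lifting property with respect to `inj S`,
where `inj S = S.rlp` is the class of morphisms with the right lifting property
with respect to `S`. -/
def cof (S : MorphismProperty C) : MorphismProperty C := S.rlp.llp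

/-- Relative `S`-cell complexes: transfinite compositions of pushouts of morphisms in `S`. -/
def cell (S : MorphismProperty C) : MorphismProperty C :=
  MorphismProperty.transfiniteCompositions.{w} S.pushouts

/-- An object `X` is cofibrant (for a class `Q` of cofibrations) if the morphism from
an initial object to `X` is a cofibration. -/
def IsCofibrantObj (Q : MorphismProperty C) (X : C) : Prop :=
  ∃ (A : C) (hA : IsInitial A), Q (hA.to X)

/-- The morphisms in `P` whose domain is cofibrant (for the class `Q` of cofibrations). -/
def withCofibrantDomain (Q P : MorphismProperty C) : MorphismProperty C :=
  fun X _ f ↦ IsCofibrantObj Q X ∧ P f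

/-- The class `W` seen as a property of objects of the category of arrows; its full subcategory
is the full subcategory of the category of arrows spanned by the elements of `W`. -/
def arrowsIn (W : MorphismProperty C) : ObjectProperty (Arrow C) := fun f ↦ W f.hom

/-- The class of morphisms `W` is `κ`-accessible: the full subcategory of the category of arrows
that it spans is closed under (small) `κ`-filtered colimits, and it is a `κ`-accessible
category. -/
structure IsCardinalAccessibleClass (W : MorphismProperty C)
    (κ : Cardinal.{w}) [Fact κ.IsRegular] : Prop where
  closedUnderColimits (K : Type w) [SmallCategory K] [IsCardinalFiltered K κ] :
    (arrowsIn W).IsClosedUnderColimitsOfShape K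
  accessible : IsCardinalAccessibleCategory (arrowsIn W).FullSubcategory κ

/-- The object `A` is small relative to the class of morphisms `D`: there is a regular cardinal
`κ` such that `Hom(A, -)` commutes with the colimit of every `κ`-filtered transfinite sequence
whose successor steps are in `D`. -/
def IsSmallRelativeTo (A : C) (D : MorphismProperty C) : Prop :=
  ∃ (κ : Cardinal.{w}) (_ : Fact κ.IsRegular),
    ∀ (K : Type w) [LinearOrder K] [SuccOrder K] [OrderBot K] [WellFoundedLT K]
      [IsCardinalFiltered K κ] (F : K ⥤ C) [F.IsWellOrderContinuous],
      (∀ k : K, ¬ IsMax k → D (F.map (homOfLE (Order.le_succ k)))) →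
        PreservesColimit F (coyoneda.obj (Opposite.op A))

/-- A functorial factorization, as a morphism in `L` followed by a morphism in `R`, of the
morphisms whose domain is cofibrant (for the class `Q` of cofibrations). -/
structure CofibrantDomainFactorization (Q L R : MorphismProperty C) where
  /-- the intermediate objects -/
  Z : (arrowsIn (withCofibrantDomain Q ⊤)).FullSubcategory ⥤ C
  /-- the first morphisms -/
  i : (arrowsIn (withCofibrantDomain Q ⊤)).ι ⋙ Arrow.leftFunc ⟶ Z
  /-- the second morphisms -/
  p : Z ⟶ (arrowsIn (withCofibrantDomain Q ⊤)).ι ⋙ Arrow.rightFunc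
  fac (f : (arrowsIn (withCofibrantDomain Q ⊤)).FullSubcategory) :
    i.app f ≫ p.app f = f.obj.hom
  hi (f : (arrowsIn (withCofibrantDomain Q ⊤)).FullSubcategory) : L (i.app f)
  hp (f : (arrowsIn (withCofibrantDomain Q ⊤)).FullSubcategory) : R (p.app f)

/-- The classes `W` (weak equivalences), `F` (fibrations), `Q` (cofibrations) form a
semi-model structure. -/
structure IsSemiModelStructure (W F Q : MorphismProperty C) : Prop where
  /-- the initial object exists and is cofibrant -/
  initial_cofibrant : ∃ (A : C) (_ : IsInitial A), IsCofibrantObj Q A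
  twoOutOfThree : W.HasTwoOutOfThreeProperty
  weq_retracts : W.IsStableUnderRetracts
  fib_retracts : F.IsStableUnderRetracts
  cof_retracts : Q.IsStableUnderRetracts
  /-- cofibrations lift against trivial fibrations -/
  cof_lifting : Q ≤ (F ⊓ W).llp
  /-- trivial cofibrations with cofibrant domain lift against fibrations -/
  trivCof_lifting : withCofibrantDomain Q (Q ⊓ W) ≤ F.llp
  cof_factorization : MorphismProperty.HasFunctorialFactorization Q (F ⊓ W)
  trivCof_factorization : Nonempty (CofibrantDomainFactorization Q (Q ⊓ W) F)
  fib_baseChange : F.IsStableUnderBaseChange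

/-- The sets of morphisms `I` and `J` are generating cofibrations and generating trivial
cofibrations for the semi-model structure with weak equivalences `W`, fibrations `F` and
cofibrations `Q`. -/
structure IsCofibrantlyGeneratedBy (W F Q I J : MorphismProperty C) : Prop where
  small_I : MorphismProperty.IsSmall.{w} I
  small_J : MorphismProperty.IsSmall.{w} J
  inj_I : I.rlp = F ⊓ W
  inj_J : J.rlp = F
  domains_I {A B : C} (i : A ⟶ B) (hi : I i) : IsSmallRelativeTo.{w} A (cell.{w} I)
  domains_J {A B : C} (j : A ⟶ B) (hj : J j) :
    IsSmallRelativeTo.{w} A (withCofibrantDomain Q (cell.{w} J))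

/-- The classes `W`, `F`, `Q` form a combinatorial semi-model structure on the bicomplete
category `C`, with generating cofibrations `I` and generating trivial cofibrations `J`. -/
structure IsCombinatorialSemiModelStructure (W F Q I J : MorphismProperty C) : Prop where
  colimits : HasColimitsOfSize.{w, w} C
  limits : HasLimitsOfSize.{w, w} C
  semiModel : IsSemiModelStructure W F Q
  generated : IsCofibrantlyGeneratedBy.{w} W F Q I J
  locallyPresentable : IsLocallyPresentable.{w} C

end Classes

end SemiModel

/-! The set `J` comes from a solution set condition. Accessibility of `W` gives a small set `W₀` of
weak equivalences such that every square from some `i` in `I` to a weak equivalence factors through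
a member of `W₀`. Each square from `i` to a member of `W₀` is then factored through a trivial
cofibration with cofibrant domain: factor the map between the sources as a cofibration followed by a
map in `inj(I)`, push `i` out along the cofibration, and factor the induced map out of the pushout
in the same way (`exists_fac_of_hom`). These trivial cofibrations form `J`.

A map in `W` with the lifting property against `J` thus lifts against `I`, and `inj(I) = inj(J) ∩ W`
follows. What remains is that a map of `cof(J)` with cofibrant domain is in `W`. The small object
argument writes it as a retract of a transfinite composition of pushouts of coproducts of maps in
`J`, but the domains occurring there need not be cofibrant, whereas hypothesis (4) only controls
cofibrant ones. Hence the class `cofibrantlyStable`: cofibrations whose cobase changes to cofibrant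
objects are all in `W`. It contains `J` and is closed under all these operations. The lifting axiom
for trivial cofibrations is then the retract argument.

The solution set condition (`exists_small_of_isCardinalAccessibleCategory`) rests on a cardinal `κ'`
for which a `κ`-directed poset is a `κ'`-directed union of `κ`-directed subsets of size `< κ'`.
Colimits over these subsets are `κ'`-presentable and still in the subcategory. -/

namespace CategoryTheory

/-! ### Completeness and arrow categories of locally presentable categories -/

/-- A cocomplete category with a small dense subcategory is a reflective subcategory of
a category of presheaves, hence it is complete. -/
lemma hasLimitsOfSize_of_isDense {S : Type w} [SmallCategory S] {C : Type u} [Category.{w} C]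
    [HasColimitsOfSize.{w, w} C] (A : S ⥤ C) [A.IsDense] :
    HasLimitsOfSize.{w, w} C := by
  have : (uliftYoneda.{w, w} (C := S)).HasPointwiseLeftKanExtension A := inferInstance
  let adj := Presheaf.uliftYonedaAdjunction.{w}
    ((uliftYoneda.{w, w} (C := S)).leftKanExtension A)
    ((uliftYoneda.{w, w} (C := S)).leftKanExtensionUnit A)
  let _ : Reflective (Presheaf.restrictedULiftYoneda.{w} A) := ⟨_, adj⟩
  exact hasLimits_of_reflective (Presheaf.restrictedULiftYoneda.{w} A)

/-- The `κ`-presentable objects form an essentially small dense subcategory. Passing to the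
equivalent category `D` puts the morphisms in universe `w`, as the presheaf embedding requires. -/
lemma IsCardinalLocallyPresentable.hasLimitsOfSize (C : Type u) [Category.{v} C]
    (κ : Cardinal.{w}) [Fact κ.IsRegular] [IsCardinalLocallyPresentable C κ] :
    HasLimitsOfSize.{w, w} C := by
  obtain ⟨D, _, ⟨e⟩⟩ := HasCardinalFilteredGenerator.exists_equivalence C κ
  have := e.isCardinalLocallyPresentable κ
  let P := isCardinalPresentable D κ
  have : EssentiallySmall.{w} P.FullSubcategory := inferInstance
  have := hasLimitsOfSize_of_isDense ((equivSmallModel.{w} P.FullSubcategory).inverse ⋙ P.ι)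
  exact Adjunction.has_limits_of_equivalence e.functor

lemma IsLocallyPresentable.hasColimitsOfSize (C : Type u) [Category.{v} C]
    [IsLocallyPresentable.{w} C] : HasColimitsOfSize.{w, w} C := by
  obtain ⟨κ, _, _⟩ := IsLocallyPresentable.exists_cardinal.{w} C
  infer_instance

lemma IsLocallyPresentable.hasLimitsOfSize (C : Type u) [Category.{v} C]
    [IsLocallyPresentable.{w} C] : HasLimitsOfSize.{w, w} C := by
  obtain ⟨κ, _, _⟩ := IsLocallyPresentable.exists_cardinal.{w} C
  exact IsCardinalLocallyPresentable.hasLimitsOfSize C κ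

lemma IsLocallyPresentable.locallySmall (C : Type u) [Category.{v} C]
    [IsLocallyPresentable.{w} C] : LocallySmall.{w} C := by
  obtain ⟨κ, _, _⟩ := IsLocallyPresentable.exists_cardinal.{w} C
  infer_instance

/-- The functor which sends an arrow to the corresponding functor from `Fin 2`. -/
@[simps]
def arrowToComposableArrows (C : Type u) [Category.{v} C] : Arrow C ⥤ ComposableArrows C 1 where
  obj f := ComposableArrows.mk₁ f.hom
  map φ := ComposableArrows.homMk₁ φ.left φ.right φ.w.symm

instance (C : Type u) [Category.{v} C] : (arrowToComposableArrows C).IsEquivalence where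
  faithful := ⟨fun {f g φ ψ} h ↦ by
    ext
    · exact congr_arg (fun α ↦ α.app 0) h
    · exact congr_arg (fun α ↦ α.app 1) h⟩
  full := ⟨fun {f g} α ↦ ⟨Arrow.homMk (α.app 0) (α.app 1)
    (α.naturality (homOfLE (show (0 : Fin 2) ≤ 1 by simp))).symm, by
      apply ComposableArrows.hom_ext₁ <;> rfl⟩⟩
  essSurj := ⟨fun F ↦ ⟨Arrow.mk (F.map' 0 1), ⟨ComposableArrows.isoMk₁ (Iso.refl _) (Iso.refl _)
    ((Category.comp_id _).trans (Category.id_comp _).symm)⟩⟩⟩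

instance isLocallyPresentable_arrow (C : Type u) [Category.{v} C] [IsLocallyPresentable.{w} C] :
    IsLocallyPresentable.{w} (Arrow C) := by
  have := IsLocallyPresentable.hasLimitsOfSize.{w} C
  have : HasLimitsOfSize.{0, 0} C := hasLimitsOfSizeShrink.{0, 0} C
  -- `Fin 2` is self-dual, so arrows are presheaves, with values in `C`, on a category in universe
  -- `w`.
  let e : (ULift.{w} (Fin 2))ᵒᵖ ≌ Fin 2 :=
    (Equivalence.op (ULift.orderIso.{w} (α := Fin 2)).equivalence).trans
      ((orderDualEquivalence (Fin 2)).symm.trans Fin.revOrderIso.equivalence)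
  exact (e.congrLeft.trans (arrowToComposableArrows C).asEquivalence.symm).isLocallyPresentable

end CategoryTheory

/-! ### Cardinal arithmetic for the change of accessibility rank -/

namespace Cardinal

open CategoryTheory CardinalDirectedPoset

/-- Arbitrarily large successors `λ` of powers of two are such that a set of cardinality `< λ`
has less than `λ` subsets of cardinality `< κ`. -/
lemma exists_regular_hasCardinalLT_setCardinalLT (κ : Cardinal.{w}) [Fact κ.IsRegular]
    (μ : Cardinal.{w}) :
    ∃ (κ' : Cardinal.{w}) (_ : Fact κ'.IsRegular), κ < κ' ∧ μ ≤ κ' ∧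
      ∀ (X : Type w), HasCardinalLT X κ' → HasCardinalLT (SetCardinalLT κ X) κ' := by
  have hκ : ℵ₀ ≤ κ := IsRegular.aleph0_le Fact.out
  -- With this `ν`, `(2 ^ ν) ^ κ ≤ 2 ^ (ν * ν) = 2 ^ ν`, so the successor of `2 ^ ν` works.
  let ν := max κ μ
  have hν : ℵ₀ ≤ ν := hκ.trans (le_max_left _ _)
  have h₂ : ν < (2 : Cardinal.{w}) ^ ν := cantor ν
  refine ⟨Order.succ (2 ^ ν), ⟨isRegular_succ (hν.trans h₂.le)⟩,
    ((le_max_left _ _).trans h₂.le).trans_lt (Order.lt_succ _),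
    ((le_max_right _ _).trans h₂.le).trans (Order.le_succ _), fun X hX ↦ ?_⟩
  rw [hasCardinalLT_iff_cardinal_mk_lt, Order.lt_succ_iff] at hX ⊢
  calc
    #(SetCardinalLT κ X) ≤ #{t : Set X // #t ≤ κ} :=
      mk_le_of_injective (f := fun t ↦ ⟨t.1, by
        simpa only [hasCardinalLT_iff_cardinal_mk_lt] using
          ((hasCardinalLT_iff_cardinal_mk_lt _ _).1 t.2).le⟩)
        (fun t₁ t₂ h ↦ Subtype.ext (congr_arg (fun t ↦ t.1) h))
    _ ≤ max #X ℵ₀ ^ κ := mk_bounded_set_le X κ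
    _ ≤ (2 ^ ν) ^ ν := (power_le_power_right (max_le hX (hν.trans h₂.le))).trans
      (power_le_power_left (aleph0_pos.trans_le (hν.trans h₂.le)).ne' (le_max_left _ _))
    _ = 2 ^ ν := by rw [← power_mul, mul_eq_self hν]

end Cardinal

namespace CategoryTheory

/-! ### Colimits over directed unions of subsets of a poset -/

section

variable {A : Type u} [Category.{v} A] {α : Type w} [PartialOrder α] (F : α ⥤ A)
  [HasColimitsOfSize.{w, w} A] (Q : Set α → Prop)

/-- The restriction of a functor from a partially ordered type to a subset. -/
@[simps]
def restrictSet (S : Set α) : S ⥤ A where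
  obj a := F.obj a.1
  map {a b} f := F.map (homOfLE (show a.1 ≤ b.1 from leOfHom f))
  map_id a := F.map_id a.1
  map_comp f g := by rw [← F.map_comp]; rfl

/-- The cocone for the restriction to a subset `S` of a functor given by the colimit
of its restriction to a larger subset. -/
@[simps]
noncomputable def coconeRestrictSet {S T : Set α} (h : S ⊆ T) : Cocone (restrictSet F S) where
  pt := colimit (restrictSet F T)
  ι :=
    { app a := colimit.ι (restrictSet F T) ⟨a.1, h a.2⟩
      naturality a b f := (colimit.w (restrictSet F T)
        (show (⟨a.1, h a.2⟩ : T) ⟶ ⟨b.1, h b.2⟩ from homOfLE (leOfHom f))).trans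
        (Category.comp_id _).symm }

/-- The cocone for the restriction to a subset of a functor given by a cocone for this functor. -/
@[simps]
def restrictSetCocone (c : Cocone F) (S : Set α) : Cocone (restrictSet F S) where
  pt := c.pt
  ι :=
    { app a := c.ι.app a.1
      naturality a b f := c.ι.naturality (homOfLE (show a.1 ≤ b.1 from leOfHom f)) }

/-- The functor which sends a subset satisfying `Q` of a partially ordered type `α`
to the colimit of the restriction of `F : α ⥤ A`. -/
noncomputable def colimitOfPredicateSet : Subtype Q ⥤ A where
  obj S := colimit (restrictSet F S.1)
  map h := colimit.desc _ (coconeRestrictSet F (leOfHom h))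
  map_id _ := colimit.hom_ext (fun a ↦
    (colimit.ι_desc (coconeRestrictSet F subset_rfl) a).trans (Category.comp_id _).symm)
  map_comp f g := colimit.hom_ext (fun a ↦
    (colimit.ι_desc _ _).trans
      ((colimit.ι_desc_assoc (coconeRestrictSet F (leOfHom f)) a _).trans
        (colimit.ι_desc (coconeRestrictSet F (leOfHom g)) ⟨a.1, leOfHom f a.2⟩)).symm)

variable {Q} in
/-- The inclusions in the colimit over a subset of the objects indexed by its elements. -/
noncomputable def ιColimitOfPredicateSet (S : Subtype Q) (a : α) (ha : a ∈ S.1) :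
    F.obj a ⟶ (colimitOfPredicateSet F Q).obj S :=
  colimit.ι (restrictSet F S.1) ⟨a, ha⟩

variable {F Q}

lemma ιColimitOfPredicateSet_map {S T : Subtype Q} (h : S ⟶ T) (a : α) (ha : a ∈ S.1) :
    ιColimitOfPredicateSet F S a ha ≫ (colimitOfPredicateSet F Q).map h =
      ιColimitOfPredicateSet F T a (leOfHom h ha) :=
  colimit.ι_desc _ _

lemma ιColimitOfPredicateSet_map_assoc {S T : Subtype Q} (h : S ⟶ T) (a : α) (ha : a ∈ S.1)
    {X : A} (f : (colimitOfPredicateSet F Q).obj T ⟶ X) :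
    ιColimitOfPredicateSet F S a ha ≫ (colimitOfPredicateSet F Q).map h ≫ f =
      ιColimitOfPredicateSet F T a (leOfHom h ha) ≫ f := by
  rw [← Category.assoc, ιColimitOfPredicateSet_map]

lemma map_ιColimitOfPredicateSet (S : Subtype Q) {a b : α} (f : a ⟶ b) (ha : a ∈ S.1)
    (hb : b ∈ S.1) :
    F.map f ≫ ιColimitOfPredicateSet F S b hb = ιColimitOfPredicateSet F S a ha :=
  colimit.w (restrictSet F S.1) (show (⟨a, ha⟩ : S.1) ⟶ ⟨b, hb⟩ from homOfLE (leOfHom f))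

lemma colimitOfPredicateSet_hom_ext {S : Subtype Q} {X : A}
    {f g : (colimitOfPredicateSet F Q).obj S ⟶ X}
    (h : ∀ (a : α) (ha : a ∈ S.1),
      ιColimitOfPredicateSet F S a ha ≫ f = ιColimitOfPredicateSet F S a ha ≫ g) : f = g :=
  colimit.hom_ext (fun a ↦ h a.1 a.2)

variable (Q) in
/-- The cocone with point the colimit of `F : α ⥤ A` given by the colimits
of the restrictions of `F`. -/
noncomputable def coconeColimitOfPredicateSet (c : Cocone F) :
    Cocone (colimitOfPredicateSet F Q) where
  pt := c.pt
  ι :=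
    { app S := colimit.desc (restrictSet F S.1) (restrictSetCocone F c S.1)
      naturality S T h := colimit.hom_ext (fun a ↦ by
        refine (ιColimitOfPredicateSet_map_assoc h a.1 a.2 _).trans ?_
        refine (colimit.ι_desc _ _).trans ?_
        exact ((congr_arg (colimit.ι (restrictSet F S.1) a ≫ ·) (Category.comp_id _)).trans
          (colimit.ι_desc (restrictSetCocone F c S.1) a)).symm) }

lemma ιColimitOfPredicateSet_cocone (c : Cocone F) (S : Subtype Q) (a : α) (ha : a ∈ S.1) :
    ιColimitOfPredicateSet F S a ha ≫ (coconeColimitOfPredicateSet Q c).ι.app S = c.ι.app a :=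
  colimit.ι_desc _ _

lemma ιColimitOfPredicateSet_cocone_assoc (c : Cocone F) (S : Subtype Q) (a : α) (ha : a ∈ S.1)
    {X : A} (f : c.pt ⟶ X) :
    ιColimitOfPredicateSet F S a ha ≫ (coconeColimitOfPredicateSet Q c).ι.app S ≫ f =
      c.ι.app a ≫ f :=
  (Category.assoc _ _ _).symm.trans (congr_arg (· ≫ f) (ιColimitOfPredicateSet_cocone c S a ha))

/-- The colimit of `F : α ⥤ A` is the colimit of the colimits of its restrictions
to the members of a directed family of subsets which cover `α`. -/
noncomputable def isColimitCoconeColimitOfPredicateSet {c : Cocone F} (hc : IsColimit c)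
    [IsDirectedOrder (Subtype Q)] (hQ : ∀ a, ∃ S, Q S ∧ a ∈ S) :
    IsColimit (coconeColimitOfPredicateSet Q c) := by
  choose S hS ha using hQ
  -- By directedness, the map out of `F.obj a` induced by `s` does not depend on the subset
  -- containing `a`.
  have key (s : Cocone (colimitOfPredicateSet F Q)) (a : α) (T₁ T₂ : Subtype Q)
      (h₁ : a ∈ T₁.1) (h₂ : a ∈ T₂.1) :
      ιColimitOfPredicateSet F T₁ a h₁ ≫ s.ι.app T₁ =
        ιColimitOfPredicateSet F T₂ a h₂ ≫ s.ι.app T₂ := by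
    obtain ⟨U, hU₁, hU₂⟩ := exists_ge_ge T₁ T₂
    rw [← s.w (homOfLE hU₁), ← s.w (homOfLE hU₂), ιColimitOfPredicateSet_map_assoc,
      ιColimitOfPredicateSet_map_assoc]
  let t (s : Cocone (colimitOfPredicateSet F Q)) : Cocone F :=
    { pt := s.pt
      ι :=
        { app a := ιColimitOfPredicateSet F ⟨S a, hS a⟩ a (ha a) ≫ s.ι.app ⟨S a, hS a⟩
          naturality a b f := by
            obtain ⟨U, hU₁, hU₂⟩ := exists_ge_ge (⟨S a, hS a⟩ : Subtype Q) ⟨S b, hS b⟩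
            rw [key s a _ U (ha a) (hU₁ (ha a)), key s b _ U (ha b) (hU₂ (ha b))]
            simp [reassoc_of% map_ιColimitOfPredicateSet U f (hU₁ (ha a)) (hU₂ (ha b))] } }
  have fac (s : Cocone (colimitOfPredicateSet F Q)) (a : α) :
      c.ι.app a ≫ hc.desc (t s) =
        ιColimitOfPredicateSet F ⟨S a, hS a⟩ a (ha a) ≫ s.ι.app ⟨S a, hS a⟩ :=
    hc.fac (t s) a
  exact
    { desc s := hc.desc (t s)
      fac s T := colimitOfPredicateSet_hom_ext (fun a h ↦
        (ιColimitOfPredicateSet_cocone_assoc c T a h _).trans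
          ((fac s a).trans (key s a _ T (ha a) h)))
      uniq s m hm := hc.hom_ext (fun a ↦ by
        rw [fac, ← hm]
        exact (ιColimitOfPredicateSet_cocone_assoc c _ a (ha a) m).symm) }

end

lemma hasCardinalLT_arrow_of_partialOrder {α : Type w} [PartialOrder α] {κ : Cardinal.{w}}
    (hκ : Cardinal.aleph0 ≤ κ) (h : HasCardinalLT α κ) : HasCardinalLT (Arrow α) κ :=
  (hasCardinalLT_prod hκ h h).of_injective (fun f ↦ (f.left, f.right)) (fun f g h ↦ by
    obtain ⟨h₁, h₂⟩ := Prod.ext_iff.1 h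
    exact Arrow.ext h₁ h₂ (Subsingleton.elim _ _))

/-! ### Solution set condition and small object argument -/

/-- In a locally presentable category, any small family of objects consists of `κ`-presentable
objects for arbitrarily large regular cardinals `κ`. -/
lemma exists_forall_isCardinalPresentable_of_le {A : Type u} [Category.{v} A]
    [IsLocallyPresentable.{w} A] (G : ObjectProperty A) [ObjectProperty.Small.{w} G] :
    ∃ (μ : Cardinal.{w}), ∀ (κ : Cardinal.{w}) [Fact κ.IsRegular] (_ : μ ≤ κ),
      G ≤ isCardinalPresentable A κ := by
  have h (X : A) : ∃ (κ : Cardinal.{w}) (_ : Fact κ.IsRegular), IsCardinalPresentable X κ :=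
    (inferInstance : IsPresentable.{w} X).exists_cardinal
  choose c _ hc using h
  obtain ⟨μ, hμ⟩ := Cardinal.bddAbove_of_small
    (s := Set.range (fun (X : Subtype G) ↦ c X.1))
  refine ⟨μ, fun κ _ hκ X hX ↦ ?_⟩
  have := hc X
  exact isCardinalPresentable_of_le X ((hμ ⟨⟨X, hX⟩, rfl⟩).trans hκ)

/-- The solution set condition for full accessible subcategories closed
under sufficiently filtered colimits. -/
lemma exists_small_of_isCardinalAccessibleCategory {A : Type u} [Category.{v} A]
    [IsLocallyPresentable.{w} A] (P : ObjectProperty A) (κ : Cardinal.{w}) [Fact κ.IsRegular]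
    (hP : ∀ (K : Type w) [SmallCategory K] [IsCardinalFiltered K κ],
      P.IsClosedUnderColimitsOfShape K)
    [IsCardinalAccessibleCategory P.FullSubcategory κ]
    (G : ObjectProperty A) [ObjectProperty.Small.{w} G] :
    ∃ (P₀ : ObjectProperty A), ObjectProperty.Small.{w} P₀ ∧ P₀ ≤ P ∧
      ∀ ⦃X Y : A⦄ (f : X ⟶ Y), G X → P Y → ∃ (Z : A) (a : X ⟶ Z) (b : Z ⟶ Y),
        P₀ Z ∧ a ≫ b = f := by
  obtain ⟨κ₀, _, _⟩ := IsLocallyPresentable.exists_cardinal.{w} A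
  obtain ⟨Q, _, hQ⟩ := HasCardinalFilteredGenerator.exists_small_generator P.FullSubcategory κ
  obtain ⟨μ₁, hμ₁⟩ := exists_forall_isCardinalPresentable_of_le G
  obtain ⟨μ₂, hμ₂⟩ := exists_forall_isCardinalPresentable_of_le (Q.strictMap P.ι)
  obtain ⟨κ', _, hκ, hκ', hcof⟩ := Cardinal.exists_regular_hasCardinalLT_setCardinalLT κ
    (κ₀ ⊔ μ₁ ⊔ μ₂)
  have h₀ : κ₀ ≤ κ' := le_sup_left.trans (le_sup_left.trans hκ')
  replace hμ₁ := hμ₁ κ' (le_sup_right.trans (le_sup_left.trans hκ'))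
  replace hμ₂ := hμ₂ κ' (le_sup_right.trans hκ')
  have hℵ₀ : Cardinal.aleph0 ≤ κ' := Cardinal.IsRegular.aleph0_le Fact.out
  have := IsCardinalLocallyPresentable.of_le A h₀
  have : ObjectProperty.EssentiallySmall.{w} (isCardinalPresentable A κ' ⊓ P) :=
    .of_le inf_le_left
  obtain ⟨P₀, _, hP₀, hP₀'⟩ := ObjectProperty.EssentiallySmall.exists_small_le.{w}
    (isCardinalPresentable A κ' ⊓ P)
  refine ⟨P₀, inferInstance, hP₀.trans inf_le_right, fun X Y f hX hY ↦ ?_⟩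
  obtain ⟨J, _, _, ⟨p⟩⟩ := hQ.exists_colimitsOfShape ⟨Y, hY⟩
  -- The indexing category is replaced by a `κ`-directed poset, so that subsets of it can be used.
  obtain ⟨α, _, _, F, _⟩ := IsCardinalFiltered.exists_cardinal_directed J κ
  have := hP α
  let q := (p.toColimitPresentation.reindex F).map P.ι
  let R (S : Set α) : Prop := IsCardinalFiltered S κ ∧ HasCardinalLT S κ'
  -- The choice of `κ'` bounds the number of subsets of size `< κ`, so adding upper bounds for them
  -- keeps the size below `κ'`.
  have hR (S : Set α) (hS : HasCardinalLT S κ') : ∃ T, R T ∧ S ⊆ T := by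
    obtain ⟨T, h₁, h₂, h₃⟩ := Cardinal.SharplyLT.exists_isCardinalFiltered_set_of_exists_cofinal
      hκ (fun X hX ↦ ⟨Set.univ, (hcof X hX).of_injective _ Subtype.val_injective,
        fun x ↦ ⟨x, Set.mem_univ _, le_rfl⟩⟩) S hS
    exact ⟨T, ⟨h₂, h₃⟩, h₁⟩
  have : IsCardinalFiltered (Subtype R) κ' := isCardinalFiltered_preorder _ _ (fun K s hK ↦ by
    obtain ⟨T, h₁, h₂⟩ := hR (⋃ k, (s k).1) (hasCardinalLT_iUnion _
      (by rwa [hasCardinalLT_iff_cardinal_mk_lt]) (fun k ↦ (s k).2.2))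
    exact ⟨⟨T, h₁⟩, fun k ↦ (Set.subset_iUnion (fun k ↦ (s k).1) k).trans h₂⟩)
  have := isFiltered_of_isCardinalFiltered (Subtype R) κ'
  have : IsDirectedOrder (Subtype R) := IsFiltered.isDirectedOrder _
  have hc := isColimitCoconeColimitOfPredicateSet (Q := R) q.isColimit (fun a ↦ by
    obtain ⟨T, h₁, h₂⟩ := hR {a} (hasCardinalLT_of_finite _ _ hℵ₀)
    exact ⟨T, h₁, h₂ rfl⟩)
  have := hμ₁ _ hX
  rw [isCardinalPresentable_iff] at this
  obtain ⟨S, g, b, hg⟩ : ∃ (S : Subtype R) (g : X ⟶ (colimitOfPredicateSet q.diag R).obj S)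
      (b : (colimitOfPredicateSet q.diag R).obj S ⟶ Y), g ≫ b = f := by
    obtain ⟨S, g, hg⟩ := IsCardinalPresentable.exists_hom_of_isColimit κ' hc f
    exact ⟨S, g, _, hg⟩
  -- The colimit over `S` is in `P` because `S` is `κ`-filtered, and is `κ'`-presentable because `S`
  -- has size `< κ'`.
  obtain ⟨Z, hZ, ⟨e⟩⟩ := hP₀' ((colimitOfPredicateSet q.diag R).obj S) (by
    obtain ⟨S, _, hS⟩ := S
    have (s : S) : IsCardinalPresentable ((restrictSet q.diag S).obj s) κ' :=
      hμ₂ _ ⟨_, p.prop_diag_obj (F.obj s.1)⟩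
    have := hP S
    exact ⟨isCardinalPresentable_of_isColimit _ (colimit.isColimit (restrictSet q.diag S)) κ'
      (hasCardinalLT_arrow_of_partialOrder hℵ₀ hS),
      P.prop_colimit _ (fun s ↦ (p.diag.obj (F.obj s.1)).property)⟩)
  exact ⟨Z, g ≫ e.hom, e.inv ≫ b, hZ, by simpa using hg⟩

/-- In a locally presentable category, any set of morphisms permits the small object argument. -/
lemma MorphismProperty.hasSmallObjectArgument_of_isLocallyPresentable {C : Type u} [Category.{v} C]
    [IsLocallyPresentable.{w} C] (I : MorphismProperty C) [MorphismProperty.IsSmall.{w} I] :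
    MorphismProperty.HasSmallObjectArgument.{w} I := by
  let G : ObjectProperty C := fun X ↦ ∃ (Y : C) (f : X ⟶ Y), I f
  have : ObjectProperty.Small.{w} G :=
    small_of_surjective (f := fun (f : I.toSet) ↦ ⟨f.1.left, f.1.right, f.1.hom, f.2⟩) (by
      rintro ⟨X, Y, f, hf⟩
      exact ⟨⟨CategoryTheory.Arrow.mk f, hf⟩, rfl⟩)
  obtain ⟨μ, hμ⟩ := exists_forall_isCardinalPresentable_of_le G
  let κ := Order.succ (max μ .aleph0)
  have : Fact κ.IsRegular := ⟨Cardinal.isRegular_succ (le_max_right _ _)⟩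
  have hκ : μ ≤ κ := (le_max_left _ _).trans (Order.le_succ _)
  have := Cardinal.nonempty_ord_toType (c := κ) (Cardinal.IsRegular.ne_zero Fact.out)
  have := IsLocallyPresentable.hasColimitsOfSize.{w} C
  have := IsLocallyPresentable.locallySmall.{w} C
  have : HasColimitsOfSize.{0, 0} C := hasColimitsOfSizeShrink.{0, 0} C
  let _ := WellFoundedLT.toOrderBot κ.ord.ToType
  exact
    { exists_cardinal := ⟨κ, inferInstance, inferInstance,
        { preservesColimit {X Y _ _} i hi f hf := by
            have : IsCardinalPresentable X κ := hμ κ hκ X ⟨Y, i, hi⟩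
            have := preservesColimitsOfShape_of_isCardinalPresentable X κ κ.ord.ToType
            infer_instance }⟩ }

/-! ### Coproducts as transfinite compositions of pushouts -/

section

variable {C : Type u} [Category.{v} C] {T : Type w}

/-- If all the members of a family of morphisms but one are isomorphisms, then
the coproduct of this family is a pushout of the remaining morphism. -/
lemma isPushout_sigmaMap_of_isIso {X Y : T → C} [HasCoproduct X] [HasCoproduct Y]
    (f : ∀ t, X t ⟶ Y t) (t₀ : T) (hf : ∀ t, t ≠ t₀ → IsIso (f t)) :
    IsPushout (f t₀) (Sigma.ι X t₀) (Sigma.ι Y t₀) (Limits.Sigma.map f) where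
  w := by simp
  isColimit' := by
    classical
    let d {Z : C} (a : Y t₀ ⟶ Z) (b : ∐ X ⟶ Z) (t : T) : Y t ⟶ Z :=
      if h : t = t₀ then eqToHom (by rw [h]) ≫ a else
        have := hf t h
        inv (f t) ≫ Sigma.ι X t ≫ b
    have hd {Z : C} (a : Y t₀ ⟶ Z) (b : ∐ X ⟶ Z) : d a b t₀ = a := by simp [d]
    have hd' {Z : C} (a : Y t₀ ⟶ Z) (b : ∐ X ⟶ Z) (w : f t₀ ≫ a = Sigma.ι X t₀ ≫ b) (t : T) :
        f t ≫ d a b t = Sigma.ι X t ≫ b := by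
      by_cases h : t = t₀
      · subst h
        rw [hd, w]
      · simp [d, h]
    refine ⟨PushoutCocone.IsColimit.mk _ (fun s ↦ Limits.Sigma.desc (d s.inl s.inr))
      (fun s ↦ by rw [Sigma.ι_desc, hd])
      (fun s ↦ Sigma.hom_ext _ _ (fun t ↦ by
        rw [Sigma.ι_map_assoc, Sigma.ι_desc, hd' _ _ s.condition]))
      (fun s m h₁ h₂ ↦ Sigma.hom_ext _ _ (fun t ↦ ?_))⟩
    rw [Sigma.ι_desc]
    by_cases h : t = t₀
    · subst h
      rw [hd, h₁]
    · have := hf t h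
      rw [← cancel_epi (f t), hd' _ _ s.condition, ← h₂, Sigma.ι_map_assoc]

end

section

variable {C : Type u} [Category.{v} C] {J : Type w} [LinearOrder J]

/-- The indicator function, with values in `Fin 2`, of the elements `> j₀`. -/
noncomputable def stepIndex (j₀ j : J) : Fin 2 := if j₀ < j then 1 else 0

lemma stepIndex_of_lt {j₀ j : J} (h : j₀ < j) : stepIndex j₀ j = 1 := if_pos h

lemma stepIndex_of_not_lt {j₀ j : J} (h : ¬ j₀ < j) : stepIndex j₀ j = 0 := if_neg h

lemma stepIndex_le {j₀ i j : J} (h : j₀ < i → j₀ < j) : stepIndex j₀ i ≤ stepIndex j₀ j := by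
  by_cases h' : j₀ < i
  · rw [stepIndex_of_lt h', stepIndex_of_lt (h h')]
  · rw [stepIndex_of_not_lt h']
    exact Fin.zero_le _

/-- The functor from a linearly ordered type which is constant with value the source of `f`
on elements `≤ j₀`, and constant with value its target on elements `> j₀`. -/
noncomputable def stepFunctor (j₀ : J) {X Y : C} (f : X ⟶ Y) : J ⥤ C where
  obj j := (ComposableArrows.mk₁ f).obj (stepIndex j₀ j)
  map φ := (ComposableArrows.mk₁ f).map (homOfLE (stepIndex_le (fun h ↦ h.trans_le (leOfHom φ))))
  map_id _ := (ComposableArrows.mk₁ f).map_id _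
  map_comp _ _ := (ComposableArrows.mk₁ f).map_comp _ _

variable (j₀ : J) {X Y : C} (f : X ⟶ Y)

lemma isIso_stepFunctor_map {i j : J} (h : j₀ < j → j₀ < i) (φ : i ⟶ j) :
    IsIso ((stepFunctor j₀ f).map φ) := by
  have (a b : Fin 2) (ψ : a ⟶ b) (hab : b ≤ a) : IsIso ((ComposableArrows.mk₁ f).map ψ) := by
    have : IsIso ψ := ⟨homOfLE hab, Subsingleton.elim _ _, Subsingleton.elim _ _⟩
    infer_instance
  exact this _ _ (homOfLE (stepIndex_le (fun h ↦ h.trans_le (leOfHom φ)))) (stepIndex_le h)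

lemma arrowMk_stepFunctor_map {i j : J} (hi : ¬ j₀ < i) (hj : j₀ < j) (φ : i ⟶ j) :
    Arrow.mk ((stepFunctor j₀ f).map φ) = Arrow.mk f := by
  have (a b : Fin 2) (ha : a = 0) (hb : b = 1) (ψ : a ⟶ b) :
      Arrow.mk ((ComposableArrows.mk₁ f).map ψ) = Arrow.mk f := by
    subst ha hb
    rfl
  exact this _ _ (stepIndex_of_not_lt hi) (stepIndex_of_lt hj)
    (homOfLE (stepIndex_le (fun h ↦ h.trans_le (leOfHom φ))))

/-- Below a limit element `m` the functor is eventually constant: if `j₀ < m`, some `i` satisfies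
`j₀ < i < m`, so the jump never occurs at `m` itself. -/
instance isWellOrderContinuous_stepFunctor : (stepFunctor j₀ f).IsWellOrderContinuous where
  nonempty_isColimit m hm := by
    obtain ⟨i, hi, hi'⟩ : ∃ (i : J) (_ : i < m), j₀ < m → j₀ < i := by
      by_cases h : j₀ < m
      · obtain ⟨i, hi, hi'⟩ := hm.lt_iff_exists_lt.1 h
        exact ⟨i, hi, fun _ ↦ hi'⟩
      · obtain ⟨i, hi⟩ := not_isMin_iff.1 hm.1
        exact ⟨i, hi, fun h' ↦ (h h').elim⟩
    have : Nonempty (Set.Iio m) := ⟨⟨i, hi⟩⟩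
    have hc : ((Set.principalSegIio m).monotone.functor ⋙
        stepFunctor j₀ f).IsEventuallyConstantFrom ⟨i, hi⟩ := fun j φ ↦
      isIso_stepFunctor_map j₀ f (fun h ↦ hi' (h.trans j.2)) (homOfLE (leOfHom φ))
    have : IsIso (((Set.principalSegIio m).cocone (stepFunctor j₀ f)).ι.app ⟨i, hi⟩) :=
      isIso_stepFunctor_map j₀ f hi' (homOfLE hi.le)
    exact ⟨hc.isColimitOfIsIso _⟩

end

section

variable {C : Type u} [Category.{v} C] {J : Type w} [PartialOrder J] {T : Type w}
  [HasCoproductsOfShape T C] (F : T → J ⥤ C)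

/-- The coproduct of a family of functors. -/
@[simps]
noncomputable def sigmaFunctor : J ⥤ C where
  obj j := ∐ fun t ↦ (F t).obj j
  map φ := Limits.Sigma.map (fun t ↦ (F t).map φ)
  map_id j := Sigma.hom_ext _ _ (by simp)
  map_comp φ ψ := Sigma.hom_ext _ _ (by simp)

instance isWellOrderContinuous_sigmaFunctor [∀ t, (F t).IsWellOrderContinuous] :
    (sigmaFunctor F).IsWellOrderContinuous where
  nonempty_isColimit m hm := by
    let c (s : Cocone ((Set.principalSegIio m).monotone.functor ⋙ sigmaFunctor F)) (t : T) :
        Cocone ((Set.principalSegIio m).monotone.functor ⋙ F t) :=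
      { pt := s.pt
        ι :=
          { app j := Sigma.ι (fun t ↦ (F t).obj j.1) t ≫ s.ι.app j
            naturality i j φ := by
              refine Eq.trans ?_ (Category.comp_id _).symm
              rw [← s.w φ]
              exact (Sigma.ι_map_assoc (fun t ↦ (F t).map (homOfLE (leOfHom φ))) t _).symm } }
    refine ⟨
      { desc s := Limits.Sigma.desc (fun t ↦
          ((F t).isColimitOfIsWellOrderContinuous m hm).desc (c s t))
        fac s j := Sigma.hom_ext _ _ (fun t ↦ ?_)
        uniq s f hf := Sigma.hom_ext _ _ (fun t ↦ ?_) }⟩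
    · refine (Sigma.ι_map_assoc (fun t ↦ (F t).map (homOfLE (le_of_lt j.2))) t _).trans ?_
      refine (congr_arg ((F t).map (homOfLE (le_of_lt j.2)) ≫ ·) (Sigma.ι_desc _ t)).trans ?_
      exact ((F t).isColimitOfIsWellOrderContinuous m hm).fac (c s t) j
    · refine Eq.trans ?_ (Sigma.ι_desc (fun t ↦
        ((F t).isColimitOfIsWellOrderContinuous m hm).desc (c s t)) t).symm
      refine ((F t).isColimitOfIsWellOrderContinuous m hm).hom_ext (fun j ↦ ?_)
      refine Eq.trans ?_ (((F t).isColimitOfIsWellOrderContinuous m hm).fac (c s t) j).symm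
      dsimp only [c]
      rw [← hf j]
      exact (Sigma.ι_map_assoc (fun t ↦ (F t).map (homOfLE (le_of_lt j.2))) t _).symm

end

/-- A class of morphisms that is stable under cobase change and under transfinite composition
is stable under coproducts. -/
lemma MorphismProperty.isStableUnderCoproducts_of_isStableUnderTransfiniteComposition
    {C : Type u} [Category.{v} C] [HasCoproducts.{w} C] (P : MorphismProperty C)
    [P.IsStableUnderCobaseChange]
    [MorphismProperty.IsStableUnderTransfiniteComposition.{w} P] :
    MorphismProperty.IsStableUnderCoproducts.{w} P where
  isStableUnderCoproductsOfShape T := by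
    have : HasCoproductsOfShape T C := inferInstance
    refine IsStableUnderCoproductsOfShape.mk _ _ (fun X₁ X₂ _ _ f hf ↦ ?_)
    -- Well-order `T` and apply the maps `f t` one at a time: passing from `t` to its successor
    -- changes only the summand `t`. The added top is the stage where every summand has been
    -- changed.
    obtain ⟨_, _⟩ := exists_wellFoundedLT T
    let _ : SuccOrder (WithTop T) := SuccOrder.ofLinearWellFoundedLT _
    let _ : OrderBot (WithTop T) := WellFoundedLT.toOrderBot _
    let F (t : T) : WithTop T ⥤ C := stepFunctor (t : WithTop T) (f t)
    have hF : P.TransfiniteCompositionOfShape (WithTop T)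
        ((sigmaFunctor F).map (homOfLE bot_le : ⊥ ⟶ ⊤)) :=
      { F := sigmaFunctor F
        isoBot := Iso.refl _
        incl := { app j := (sigmaFunctor F).map (homOfLE le_top)
                  naturality i j φ := by
                    rw [← Functor.map_comp]
                    exact (Category.comp_id _).symm }
        isColimit := colimitOfDiagramTerminal isTerminalTop _
        fac := Category.id_comp _
        map_mem j hj := by
          obtain ⟨t, rfl⟩ := WithTop.ne_top_iff_exists.1 (show j ≠ ⊤ by
            rintro rfl
            exact hj isMax_top)
          refine P.of_isPushout (isPushout_sigmaMap_of_isIso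
            (fun s ↦ (F s).map (homOfLE (Order.le_succ (t : WithTop T)))) t
              (fun s hs ↦ ?_)).flip ?_
          · refine isIso_stepFunctor_map _ _ (fun h ↦ ?_) _
            exact lt_of_le_of_ne ((Order.lt_succ_iff_of_not_isMax hj).1 h)
              (fun h ↦ hs (WithTop.coe_injective h))
          · rw [← P.arrow_mk_mem_toSet_iff, arrowMk_stepFunctor_map _ _ (lt_irrefl _)
              (Order.lt_succ_of_not_isMax hj)]
            exact hf t }
    have h₁ (a b : T → CategoryTheory.Arrow C) (h : a = b)
        (ha : P (Limits.Sigma.map (fun t ↦ (a t).hom))) :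
        P (Limits.Sigma.map (fun t ↦ (b t).hom)) := by
      subst h
      exact ha
    have h₂ : P (Limits.Sigma.map (fun t ↦ (F t).map (homOfLE bot_le : ⊥ ⟶ ⊤))) :=
      P.transfiniteCompositionsOfShape_le (WithTop T) _ ⟨hF⟩
    exact h₁ (fun t ↦ .mk ((F t).map (homOfLE bot_le))) (fun t ↦ .mk (f t)) (funext (fun t ↦
      arrowMk_stepFunctor_map _ _ not_lt_bot (WithTop.coe_lt_top t) _)) h₂

/-! ### Cobase change of transfinite compositions -/

section

variable {C : Type u} [Category.{v} C]

/-- The cobase change of a colimit cocone along a morphism, when the index category has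
an initial-like object. -/
lemma nonempty_isColimit_of_isPushout {K : Type*} [Category* K] (k₀ : K)
    (hk₀ : ∀ k, Nonempty (k₀ ⟶ k)) {D D' : K ⥤ C} (φ : D ⟶ D') {A B : C} (g : A ⟶ B)
    (a : ∀ k, A ⟶ D.obj k) (b : ∀ k, B ⟶ D'.obj k)
    (hb : ∀ ⦃i j : K⦄ (ψ : i ⟶ j), b i ≫ D'.map ψ = b j)
    (sq : ∀ k, IsPushout (a k) g (φ.app k) (b k))
    {c : Cocone D} (hc : IsColimit c) (c' : Cocone D') (f : c.pt ⟶ c'.pt)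
    (hf : ∀ k, c.ι.app k ≫ f = φ.app k ≫ c'.ι.app k)
    (sq' : IsPushout (a k₀ ≫ c.ι.app k₀) g f (b k₀ ≫ c'.ι.app k₀)) :
    Nonempty (IsColimit c') := by
  have hb' (s : Cocone D') (k : K) : b k ≫ s.ι.app k = b k₀ ≫ s.ι.app k₀ := by
    obtain ⟨ψ⟩ := hk₀ k
    rw [← hb ψ, Category.assoc, s.w]
  let t (s : Cocone D') : Cocone D := (Cocone.precompose φ).obj s
  have ht (s : Cocone D') (k : K) : c.ι.app k ≫ hc.desc (t s) = φ.app k ≫ s.ι.app k :=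
    hc.fac (t s) k
  have w (s : Cocone D') :
      (a k₀ ≫ c.ι.app k₀) ≫ hc.desc (t s) = g ≫ b k₀ ≫ s.ι.app k₀ := by
    rw [Category.assoc, ht, ← Category.assoc, (sq k₀).w, Category.assoc]
  refine ⟨{ desc s := sq'.desc _ _ (w s), fac s k := ?_, uniq s m hm := ?_ }⟩
  · apply (sq k).hom_ext
    · rw [← reassoc_of% hf k, sq'.inl_desc, ht]
    · rw [← Category.assoc, hb' c', sq'.inr_desc, ← hb' s k]
  · apply sq'.hom_ext
    · rw [sq'.inl_desc]
      refine hc.hom_ext (fun k ↦ ?_)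
      rw [reassoc_of% hf k, hm, ht]
    · rw [sq'.inr_desc, Category.assoc, hm]

variable {J : Type w} [LinearOrder J] [OrderBot J]

section

variable [HasPushouts C] (F : J ⥤ C) {B : C} (g : F.obj ⊥ ⟶ B)

/-- The objects of the cobase change of a functor `F` from a linearly ordered type along
a morphism `F.obj ⊥ ⟶ B`. -/
noncomputable def cobaseChangeObj (j : J) : C := pushout (F.map (homOfLE bot_le : ⊥ ⟶ j)) g

/-- The canonical morphism to the cobase change. -/
noncomputable def toCobaseChangeObj (j : J) : F.obj j ⟶ cobaseChangeObj F g j :=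
  pushout.inl _ _

/-- The canonical morphism from the new source to the cobase change. -/
noncomputable def ofCobaseChangeObj (j : J) : B ⟶ cobaseChangeObj F g j :=
  pushout.inr _ _

lemma isPushout_cobaseChangeObj (j : J) :
    IsPushout (F.map (homOfLE bot_le : ⊥ ⟶ j)) g
      (toCobaseChangeObj F g j) (ofCobaseChangeObj F g j) :=
  IsPushout.of_hasPushout _ _

lemma map_comp_toCobaseChangeObj {i j : J} (ψ : i ⟶ j) :
    F.map (homOfLE bot_le : ⊥ ⟶ i) ≫ F.map ψ ≫ toCobaseChangeObj F g j =
      g ≫ ofCobaseChangeObj F g j := by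
  rw [← (isPushout_cobaseChangeObj F g j).w, ← Category.assoc, ← F.map_comp]
  rfl

/-- The maps of the cobase change of a functor from a linearly ordered type. -/
noncomputable def cobaseChangeMap {i j : J} (ψ : i ⟶ j) :
    cobaseChangeObj F g i ⟶ cobaseChangeObj F g j :=
  (isPushout_cobaseChangeObj F g i).desc _ _ (map_comp_toCobaseChangeObj F g ψ)

lemma toCobaseChangeObj_map {i j : J} (ψ : i ⟶ j) :
    toCobaseChangeObj F g i ≫ cobaseChangeMap F g ψ = F.map ψ ≫ toCobaseChangeObj F g j :=
  (isPushout_cobaseChangeObj F g i).inl_desc _ _ _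

lemma ofCobaseChangeObj_map {i j : J} (ψ : i ⟶ j) :
    ofCobaseChangeObj F g i ≫ cobaseChangeMap F g ψ = ofCobaseChangeObj F g j :=
  (isPushout_cobaseChangeObj F g i).inr_desc _ _ _

/-- The cobase change of a functor `F` from a linearly ordered type along
a morphism `F.obj ⊥ ⟶ B`. -/
noncomputable def cobaseChangeFunctor : J ⥤ C where
  obj := cobaseChangeObj F g
  map ψ := cobaseChangeMap F g ψ
  map_id j := by
    apply (isPushout_cobaseChangeObj F g j).hom_ext
    · rw [toCobaseChangeObj_map, F.map_id, Category.id_comp, Category.comp_id]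
    · rw [ofCobaseChangeObj_map, Category.comp_id]
  map_comp {i j k} ψ ψ' := by
    apply (isPushout_cobaseChangeObj F g i).hom_ext
    · rw [toCobaseChangeObj_map, F.map_comp, ← Category.assoc (toCobaseChangeObj F g i),
        toCobaseChangeObj_map, Category.assoc, Category.assoc, toCobaseChangeObj_map]
    · rw [ofCobaseChangeObj_map, ← Category.assoc, ofCobaseChangeObj_map,
        ofCobaseChangeObj_map]

end

/-- The cobase change of a transfinite composition is a transfinite composition
of cobase changes. -/
lemma TransfiniteCompositionOfShape.exists_of_isPushout [HasPushouts C]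
    [SuccOrder J] [WellFoundedLT J] {X Y X' Y' : C} {f : X ⟶ Y} {g : X ⟶ X'}
    {g' : Y ⟶ Y'} {f' : X' ⟶ Y'} (h : TransfiniteCompositionOfShape J f)
    (sq : IsPushout f g g' f') :
    ∃ (h' : TransfiniteCompositionOfShape J f') (φ : h.F ⟶ h'.F),
      ∀ ⦃i j : J⦄ (ψ : i ⟶ j),
        IsPushout (h.F.map ψ) (φ.app i) (φ.app j) (h'.F.map ψ) := by
  let g₀ : h.F.obj ⊥ ⟶ X' := h.isoBot.hom ≫ g
  let F' := cobaseChangeFunctor h.F g₀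
  let φ : h.F ⟶ F' :=
    { app j := toCobaseChangeObj h.F g₀ j
      naturality i j ψ := (toCobaseChangeObj_map h.F g₀ ψ).symm }
  let b (j : J) : X' ⟶ F'.obj j := ofCobaseChangeObj h.F g₀ j
  have hb ⦃i j : J⦄ (ψ : i ⟶ j) : b i ≫ F'.map ψ = b j := ofCobaseChangeObj_map h.F g₀ ψ
  have sqj (j : J) : IsPushout (h.F.map (homOfLE bot_le : ⊥ ⟶ j)) g₀ (φ.app j) (b j) :=
    isPushout_cobaseChangeObj h.F g₀ j
  have sqφ ⦃i j : J⦄ (ψ : i ⟶ j) :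
      IsPushout (h.F.map ψ) (φ.app i) (φ.app j) (F'.map ψ) := by
    refine IsPushout.of_left ?_ (φ.naturality ψ) (sqj i)
    rw [← h.F.map_comp, hb]
    exact sqj j
  have : IsIso (b ⊥) := by
    have : IsIso (h.F.map (homOfLE bot_le : (⊥ : J) ⟶ ⊥)) := by
      have : (homOfLE bot_le : (⊥ : J) ⟶ ⊥) = 𝟙 _ := rfl
      rw [this]
      infer_instance
    exact (sqj ⊥).isIso_inr_of_isIso
  have hι (j : J) : h.F.map (homOfLE bot_le : ⊥ ⟶ j) ≫ h.incl.app j = h.isoBot.hom ≫ f := by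
    refine (h.incl.naturality _).trans ?_
    refine (Category.comp_id _).trans ?_
    rw [← Iso.inv_comp_eq]
    exact h.fac
  have hw (j : J) : h.F.map (homOfLE bot_le : ⊥ ⟶ j) ≫ h.incl.app j ≫ g' = g₀ ≫ f' := by
    rw [reassoc_of% hι j, sq.w, Category.assoc]
  let c' : Cocone F' :=
    { pt := Y'
      ι := { app j := (sqj j).desc (h.incl.app j ≫ g') f' (hw j)
             naturality i j ψ := by
              apply (sqj i).hom_ext
              · rw [(sqj i).inl_desc_assoc, ← (φ.naturality_assoc ψ), (sqj j).inl_desc]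
                refine Eq.trans (Category.assoc _ _ _).symm ?_
                refine Eq.trans ?_ (Category.comp_id _).symm
                exact congr_arg (· ≫ g') ((h.incl.naturality ψ).trans (Category.comp_id _))
              · rw [(sqj i).inr_desc_assoc, reassoc_of% hb ψ, (sqj j).inr_desc]
                exact (Category.comp_id _).symm } }
  have hc' : Nonempty (IsColimit c') := by
    refine nonempty_isColimit_of_isPushout ⊥ (fun k ↦ ⟨homOfLE bot_le⟩) φ g₀ _ b hb sqj
      h.isColimit c' g' (fun k ↦ ((sqj k).inl_desc _ _ _).symm) ?_
    have e : b ⊥ ≫ c'.ι.app ⊥ = f' := (sqj ⊥).inr_desc _ _ _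
    rw [e]
    refine sq.of_iso h.isoBot.symm (Iso.refl _) (Iso.refl _) (Iso.refl _) ?_ ?_ ?_ ?_
    · exact (Category.comp_id _).trans ((Iso.eq_inv_comp _).2 (hι ⊥).symm)
    · simp [g₀]
    · simp
    · simp
  -- At a limit `m`, the argument is that of `hc'`, applied to the restriction to elements `< m`.
  have hF' : F'.IsWellOrderContinuous :=
    { nonempty_isColimit m hm := by
        have hm' : ⊥ < m := hm.bot_lt
        refine nonempty_isColimit_of_isPushout
          (D := (Set.principalSegIio m).monotone.functor ⋙ h.F)
          (⟨⊥, hm'⟩ : Set.Iio m) (fun k ↦ ⟨homOfLE bot_le⟩)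
          (Functor.whiskerLeft _ φ) g₀ (fun k ↦ h.F.map (homOfLE bot_le)) (fun k ↦ b k)
          (fun i j ψ ↦ hb _) (fun k ↦ sqj k) (h.F.isColimitOfIsWellOrderContinuous m hm) _
          (φ.app m) (fun k ↦ φ.naturality _) ?_
        have e₁ : h.F.map (homOfLE bot_le : ⊥ ⟶ ⊥) ≫ h.F.map (homOfLE hm'.le) =
            h.F.map (homOfLE bot_le : ⊥ ⟶ m) := (h.F.map_comp _ _).symm
        have e₂ : b ⊥ ≫ F'.map (homOfLE hm'.le) = b m := hb _
        have := sqj m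
        rw [← e₁, ← e₂] at this
        exact this }
  exact ⟨{ F := F', isoBot := (asIso (b ⊥)).symm, incl := c'.ι, isColimit := hc'.some
           fac := (sqj ⊥).inr_desc _ _ _ }, φ, sqφ⟩

end

end CategoryTheory

/-! ### Cofibrantly stable maps and the generating trivial cofibrations -/

namespace SemiModel

variable {C : Type u} [Category.{v} C]

lemma IsCofibrantObj.of_hom {Q : MorphismProperty C} [Q.IsStableUnderComposition] {X Y : C}
    (hX : IsCofibrantObj Q X) (f : X ⟶ Y) (hf : Q f) : IsCofibrantObj Q Y := by
  obtain ⟨A, hA, h⟩ := hX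
  refine ⟨A, hA, ?_⟩
  rw [← hA.hom_ext (hA.to X ≫ f) (hA.to Y)]
  exact Q.comp_mem _ _ h hf

/-- The morphisms in `Q` all of whose cobase changes to a cofibrant object belong to `W`. -/
def cofibrantlyStable (Q W : MorphismProperty C) : MorphismProperty C :=
  fun X Y f ↦ Q f ∧ ∀ ⦃X' Y' : C⦄ (g : X ⟶ X') (g' : Y ⟶ Y') (f' : X' ⟶ Y'),
    IsPushout f g g' f' → IsCofibrantObj Q X' → W f'

section

variable (Q W : MorphismProperty C)

lemma cofibrantlyStable_le : cofibrantlyStable Q W ≤ Q := fun _ _ _ hf ↦ hf.1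

variable {Q W} in
lemma cofibrantlyStable.mem {X Y : C} {f : X ⟶ Y} (hf : cofibrantlyStable Q W f)
    (hX : IsCofibrantObj Q X) : W f :=
  hf.2 _ _ _ (IsPushout.of_vert_isIso (f := f) (g := 𝟙 X) (inl := 𝟙 Y) (inr := f) ⟨by simp⟩) hX

instance [Q.IsStableUnderCobaseChange] :
    (cofibrantlyStable Q W).IsStableUnderCobaseChange where
  of_isPushout sq hf :=
    ⟨Q.of_isPushout sq hf.1, fun _ _ _ _ _ sq' hX ↦
      hf.2 _ _ _ (sq.flip.paste_vert sq') hX⟩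

/-- If `f` is a retract of `f₁`, its cobase change along `g` is a retract of that of `f₁` along
`r.r.left ≫ g`, with identities on `X'`. Only `X'` has to be cofibrant, not the source of `f₁`. -/
instance [HasPushouts C] [Q.IsStableUnderRetracts] [W.IsStableUnderRetracts] :
    (cofibrantlyStable Q W).IsStableUnderRetracts where
  of_retract {X Y X₁ Y₁ f f₁} r hf₁ := by
    refine ⟨Q.of_retract r hf₁.1, fun X' Y' g g' f' sq hX' ↦ ?_⟩
    have hl : r.i.left ≫ r.r.left = 𝟙 X := congr_arg Arrow.Hom.left r.retract
    have hr : r.i.right ≫ r.r.right = 𝟙 Y := congr_arg Arrow.Hom.right r.retract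
    have sq₁ := IsPushout.of_hasPushout f₁ (r.r.left ≫ g)
    have w : f ≫ r.i.right ≫ pushout.inl f₁ (r.r.left ≫ g) = g ≫ pushout.inr _ _ := by
      rw [← r.i_w_assoc, sq₁.w, Category.assoc, reassoc_of% hl]
      exact Category.id_comp _
    have w₁ : f₁ ≫ r.r.right ≫ g' = (r.r.left ≫ g) ≫ f' := by
      rw [← r.r_w_assoc, sq.w, Category.assoc]
    refine W.of_retract (g := pushout.inr f₁ (r.r.left ≫ g))
      { i := Arrow.homMk (𝟙 _) (sq.desc _ _ w) ?_
        r := Arrow.homMk (𝟙 _) (sq₁.desc _ _ w₁) ?_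
        retract := ?_ } (hf₁.2 _ _ _ sq₁ hX')
    · refine (Category.id_comp _).trans ?_
      exact (sq.inr_desc _ _ _).symm
    · refine (Category.id_comp _).trans ?_
      exact (sq₁.inr_desc _ _ _).symm
    · apply Arrow.hom_ext
      · exact Category.id_comp _
      · apply sq.hom_ext
        · refine (sq.inl_desc_assoc _ _ _ _).trans ?_
          have e := r.i.right ≫= sq₁.inl_desc _ _ w₁
          rw [reassoc_of% hr, ← Category.assoc] at e
          exact e.trans ((Category.id_comp _).trans (Category.comp_id _).symm)
        · refine (sq.inr_desc_assoc _ _ _ _).trans ?_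
          exact (sq₁.inr_desc _ _ _).trans (Category.comp_id _).symm

/-- After cobase change to a cofibrant object, every stage is cofibrant, so every step is a trivial
cofibration with cofibrant domain and `hW` applies. -/
lemma isStableUnderTransfiniteComposition_cofibrantlyStable [HasPushouts C]
    [Q.IsStableUnderCobaseChange] [MorphismProperty.IsStableUnderTransfiniteComposition.{w} Q]
    (hW : ∀ {X Y : C} (f : X ⟶ Y), IsCofibrantObj Q X →
      MorphismProperty.transfiniteCompositions.{w} (withCofibrantDomain Q (Q ⊓ W)) f → W f) :
    MorphismProperty.IsStableUnderTransfiniteComposition.{w} (cofibrantlyStable Q W) where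
  isStableUnderTransfiniteCompositionOfShape J _ _ _ _ := ⟨by
    rintro X Y f ⟨h⟩
    refine ⟨Q.transfiniteCompositionsOfShape_le J _ ⟨h.ofLE (cofibrantlyStable_le Q W)⟩,
      fun X' Y' g g' f' sq hX' ↦ ?_⟩
    obtain ⟨h', φ, hφ⟩ := h.toTransfiniteCompositionOfShape.exists_of_isPushout sq
    let h'Q : Q.TransfiniteCompositionOfShape J f' :=
      { h' with map_mem j hj := Q.of_isPushout (hφ _).flip (h.map_mem j hj).1 }
    have hcof (j : J) : IsCofibrantObj Q (h'.F.obj j) :=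
      (hX'.of_hom h'.isoBot.inv (Q.of_isIso _)).of_hom _
        (Q.transfiniteCompositionsOfShape_le _ _ ⟨h'Q.iic j⟩)
    refine hW f' hX' (MorphismProperty.transfiniteCompositionsOfShape_le_transfiniteCompositions
      _ J _ ⟨{ h' with map_mem j hj := ⟨hcof j, ?_, ?_⟩ }⟩)
    · exact h'Q.map_mem j hj
    · exact (h.map_mem j hj).2 _ _ _ (hφ _) (hcof j)⟩

end

lemma isSmallRelativeTo_of_isPresentable (A : C) [IsPresentable.{w} A]
    (D : MorphismProperty C) : IsSmallRelativeTo.{w} A D := by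
  obtain ⟨κ, _, _⟩ := Functor.IsAccessible.exists_cardinal.{w} (F := coyoneda.obj (.op A))
  have : IsCardinalPresentable A κ := ‹_›
  refine ⟨κ, inferInstance, fun K _ _ _ _ _ F _ _ ↦ ?_⟩
  have := preservesColimitsOfShape_of_isCardinalPresentable A κ K
  infer_instance

/-- A morphism of arrows from an element of `I` to a weak equivalence factors through a
trivial cofibration with cofibrant domain. -/
lemma exists_fac_of_hom [HasPushouts C] (W I : MorphismProperty C)
    [MorphismProperty.HasFactorization I.rlp.llp I.rlp]
    [W.HasTwoOutOfThreeProperty] (hinj : I.rlp ≤ W)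
    {i f : Arrow C} (φ : i ⟶ f) (hi : I i.hom) (hi' : IsCofibrantObj (cof I) i.left)
    (hf : W f.hom) :
    ∃ (j : Arrow C) (a : i ⟶ j) (b : j ⟶ f),
      withCofibrantDomain (cof I) (cof I ⊓ W) j.hom ∧ a ≫ b = φ := by
  -- The source of `φ` is cofibrant, so the middle object of this factorization is too; it becomes
  -- the source of `j`.
  let d := MorphismProperty.factorizationData I.rlp.llp I.rlp φ.left
  have w : i.hom ≫ φ.right = d.i ≫ d.p ≫ f.hom := by
    rw [d.fac_assoc]
    exact φ.w.symm
  let e := MorphismProperty.factorizationData I.rlp.llp I.rlp (pushout.desc _ _ w)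
  have he : (pushout.inr _ _ ≫ e.i) ≫ e.p = d.p ≫ f.hom := by
    rw [Category.assoc, e.fac, pushout.inr_desc]
  have hj : W (pushout.inr i.hom d.i ≫ e.i) := by
    refine W.of_postcomp _ _ (hinj _ e.hp) ?_
    rw [he]
    exact W.comp_mem _ _ (hinj _ d.hp) hf
  refine ⟨.mk (pushout.inr i.hom d.i ≫ e.i),
    Arrow.homMk d.i (pushout.inl _ _ ≫ e.i) (pushout.condition_assoc _).symm,
    Arrow.homMk d.p e.p he.symm, ⟨?_, ?_, ?_⟩, ?_⟩
  · have : (cof I).IsStableUnderComposition :=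
      inferInstanceAs I.rlp.llp.IsStableUnderComposition
    exact hi'.of_hom d.i d.hi
  · refine I.rlp.llp.comp_mem _ _ ?_ e.hi
    exact I.rlp.llp.of_isPushout (IsPushout.of_hasPushout _ _).flip (I.le_llp_rlp _ hi)
  · exact hj
  · ext
    · exact d.fac
    · exact (Category.assoc _ _ _).trans ((congr_arg _ e.fac).trans (pushout.inl_desc _ _ _))

variable [IsLocallyPresentable.{w} C]

/-- The solution set condition for weak equivalences: there is a set of trivial cofibrations
with cofibrant domain through which factors every morphism of arrows from an element of `I`
to a weak equivalence. -/
lemma exists_isSmall_of_isCardinalAccessibleClass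
    (W I : MorphismProperty C) [MorphismProperty.IsSmall.{w} I]
    (κ : Cardinal.{w}) [Fact κ.IsRegular] (hacc : IsCardinalAccessibleClass W κ)
    [W.HasTwoOutOfThreeProperty] (hinj : I.rlp ≤ W)
    (hdomains : ∀ {A B : C} (i : A ⟶ B), I i → IsCofibrantObj (cof I) A) :
    ∃ J : MorphismProperty C, MorphismProperty.IsSmall.{w} J ∧
      J ≤ withCofibrantDomain (cof I) (cof I ⊓ W) ∧
      ∀ ⦃i f : Arrow C⦄ (φ : i ⟶ f), I i.hom → W f.hom →
        ∃ (j : Arrow C) (a : i ⟶ j) (b : j ⟶ f), J j.hom ∧ a ≫ b = φ := by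
  have := IsLocallyPresentable.hasColimitsOfSize.{w} C
  have : HasColimitsOfSize.{0, 0} C := hasColimitsOfSizeShrink.{0, 0} C
  have := MorphismProperty.hasSmallObjectArgument_of_isLocallyPresentable.{w} I
  have := IsLocallyPresentable.locallySmall.{w} (Arrow C)
  have := hacc.accessible
  let G : ObjectProperty (Arrow C) := arrowsIn I
  have : ObjectProperty.Small.{w} G := inferInstanceAs (Small.{w} I.toSet)
  obtain ⟨W₀, _, hW₀, fac⟩ := exists_small_of_isCardinalAccessibleCategory (arrowsIn W) κ
    (fun K _ _ ↦ hacc.closedUnderColimits K) G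
  -- This type is `w`-small, since `I` and `W₀` are small and `Arrow C` is locally small; hence so
  -- is the resulting family `J`.
  let ι := Σ (i : Subtype G) (f : Subtype W₀), i.1 ⟶ f.1
  have (x : ι) := exists_fac_of_hom W I hinj x.2.2 x.1.2 (hdomains _ x.1.2) (hW₀ _ x.2.1.2)
  choose j a b hj hab using this
  refine ⟨MorphismProperty.ofHoms (fun x ↦ (j x).hom), ?_, ?_, fun i f φ hi hf ↦ ?_⟩
  · infer_instance
  · rintro _ _ _ ⟨x⟩
    exact hj x
  · obtain ⟨f₀, c, d, hf₀, rfl⟩ := fac φ hi hf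
    let x : ι := ⟨⟨i, hi⟩, ⟨f₀, hf₀⟩, c⟩
    exact ⟨j x, a x, b x ≫ d, ⟨x⟩, by rw [reassoc_of% hab x]⟩

end SemiModel

/-! ### The semi-model structure -/

theorem theoremB {C : Type u} [Category.{v} C] [IsLocallyPresentable.{w} C]
    (W I : MorphismProperty C) (hI : MorphismProperty.IsSmall.{w} I)
    (κ : Cardinal.{w}) [Fact κ.IsRegular]
    (hacc : SemiModel.IsCardinalAccessibleClass W κ)
    (hretracts : W.IsStableUnderRetracts)
    (htwo : W.HasTwoOutOfThreeProperty)
    (hinj : I.rlp ≤ W)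
    (hpushout : ∀ {A B X Y : C} (f : A ⟶ B) (g : A ⟶ X) (g' : B ⟶ Y) (f' : X ⟶ Y),
      IsPushout f g g' f' →
      SemiModel.withCofibrantDomain (SemiModel.cof I) (SemiModel.cof I ⊓ W) f →
      SemiModel.IsCofibrantObj (SemiModel.cof I) X →
      (SemiModel.cof I ⊓ W) f')
    (htransfinite : ∀ {X Y : C} (f : X ⟶ Y),
      SemiModel.IsCofibrantObj (SemiModel.cof I) X →
      MorphismProperty.transfiniteCompositions.{w}
        (SemiModel.withCofibrantDomain (SemiModel.cof I) (SemiModel.cof I ⊓ W)) f →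
      (SemiModel.cof I ⊓ W) f)
    (hdomains : ∀ {A B : C} (i : A ⟶ B), I i → SemiModel.IsCofibrantObj (SemiModel.cof I) A)
    (hinitial : ∃ (A : C) (_ : IsInitial A), SemiModel.IsCofibrantObj (SemiModel.cof I) A) :
    ∃ J : MorphismProperty C,
      SemiModel.IsCombinatorialSemiModelStructure.{w} W J.rlp (SemiModel.cof I) I J ∧
      J ≤ SemiModel.withCofibrantDomain (SemiModel.cof I) (SemiModel.cof I ⊓ W) := by
  obtain ⟨J, _, hJ, fac⟩ :=
    SemiModel.exists_isSmall_of_isCardinalAccessibleClass W I κ hacc hinj hdomains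
  have hC := IsLocallyPresentable.hasColimitsOfSize.{w} C
  have : HasColimitsOfSize.{0, 0} C := hasColimitsOfSizeShrink.{0, 0} C
  have := MorphismProperty.hasSmallObjectArgument_of_isLocallyPresentable.{w} I
  have := MorphismProperty.hasSmallObjectArgument_of_isLocallyPresentable.{w} J
  have hJI : J.rlp.llp ≤ SemiModel.cof I := by
    have h : J ≤ I.rlp.llp := fun _ _ _ hf ↦ (hJ _ hf).2.1
    refine (MorphismProperty.antitone_llp (MorphismProperty.antitone_rlp h)).trans ?_
    rw [MorphismProperty.rlp_llp_rlp]
    exact le_rfl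
  have inj_I : I.rlp = J.rlp ⊓ W := by
    refine le_antisymm (le_inf ?_ hinj) (fun X Y p hp A B i hi ↦ ⟨fun {f g} sq ↦ ?_⟩)
    · rw [← MorphismProperty.le_llp_iff_le_rlp]
      exact J.le_llp_rlp.trans hJI
    · obtain ⟨j, a, b, hj, hab⟩ := fac (Arrow.homMk (u := f) (v := g) sq.w :
        Arrow.mk i ⟶ Arrow.mk p) hi hp.2
      have := hp.1 _ hj
      have sq' : CommSq b.left j.hom p b.right := ⟨b.w⟩
      exact ⟨⟨{ l := a.right ≫ sq'.lift
                fac_left := by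
                  have e : i ≫ a.right = a.left ≫ j.hom := a.w.symm
                  rw [reassoc_of% e, sq'.fac_left]
                  exact congr_arg Arrow.Hom.left hab
                fac_right := by
                  rw [Category.assoc, sq'.fac_right]
                  exact congr_arg Arrow.Hom.right hab }⟩⟩
  have cof_W {X Y : C} (f : X ⟶ Y) (hf : J.rlp.llp f)
      (hX : SemiModel.IsCofibrantObj (SemiModel.cof I) X) : W f := by
    let P := SemiModel.cofibrantlyStable I.rlp.llp W
    have : MorphismProperty.IsStableUnderTransfiniteComposition.{w} P :=
      SemiModel.isStableUnderTransfiniteComposition_cofibrantlyStable _ _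
        (fun f hX hf ↦ (htransfinite f hX hf).2)
    have := MorphismProperty.isStableUnderCoproducts_of_isStableUnderTransfiniteComposition.{w} P
    have hP : J.rlp.llp ≤ P := by
      rw [MorphismProperty.llp_rlp_of_hasSmallObjectArgument.{w},
        MorphismProperty.retracts_le_iff, MorphismProperty.transfiniteCompositions_le_iff,
        MorphismProperty.pushouts_le_iff, MorphismProperty.coproducts_le_iff]
      exact fun _ _ j hj ↦ ⟨(hJ _ hj).2.1, fun _ _ g g' f' sq hX ↦
        (hpushout _ _ _ _ sq (hJ _ hj) hX).2⟩
    exact (hP _ hf).mem hX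
  let d := MorphismProperty.functorialFactorizationData J.rlp.llp J.rlp
  refine ⟨J, ⟨hC, IsLocallyPresentable.hasLimitsOfSize.{w} C, ?_, ?_, inferInstance⟩, hJ⟩
  · exact
      { initial_cofibrant := hinitial
        twoOutOfThree := htwo
        weq_retracts := hretracts
        fib_retracts := inferInstance
        cof_retracts := inferInstanceAs I.rlp.llp.IsStableUnderRetracts
        cof_lifting := by
          rw [← inj_I]
          exact le_rfl
        trivCof_lifting := by
          rintro X Y f ⟨hX, hf, hf'⟩
          -- Retract argument: by two out of three `d.p` is in `W`, hence in `inj(I)`. So `f` lifts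
          -- against it and is a retract of `d.i`.
          let d := MorphismProperty.factorizationData J.rlp.llp J.rlp f
          have hp : I.rlp d.p := by
            rw [inj_I]
            exact ⟨d.hp, W.of_precomp d.i d.p (cof_W _ d.hi hX) (by rwa [d.fac])⟩
          have := hf _ hp
          exact J.rlp.llp.of_retract (RetractArrow.ofLeftLiftingProperty d.fac) d.hi
        cof_factorization := by
          rw [← inj_I]
          exact inferInstanceAs (MorphismProperty.HasFunctorialFactorization I.rlp.llp I.rlp)
        trivCof_factorization :=
          ⟨{ Z := (SemiModel.arrowsIn (SemiModel.withCofibrantDomain (SemiModel.cof I) ⊤)).ι ⋙ d.Z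
             i := Functor.whiskerLeft _ d.i
             p := Functor.whiskerLeft _ d.p
             fac f := d.fac_app
             hi f := ⟨hJI _ (d.hi _), cof_W _ (d.hi _) f.2.1⟩
             hp f := d.hp _ }⟩
        fib_baseChange := inferInstance }
  · exact
      { small_I := hI
        small_J := inferInstance
        inj_I := inj_I
        inj_J := rfl
        domains_I _ _ := SemiModel.isSmallRelativeTo_of_isPresentable _ _
        domains_J _ _ := SemiModel.isSmallRelativeTo_of_isPresentable _ _ }
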